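/- Let $\Sigma=(A,B,C,D)$ and $\tilde\Sigma=(\tilde A,\tilde B,\tilde C,\tilde D)$ be real linear time-invariant systems $\dot x=Ax+Bu,\ x(0)=0,\ y=Cx+Du$ (and likewise for $\tilde\Sigma$) with $m$ inputs and $m$ outputs and with state dimensions $n$ and $r$, and let $G(s)=C(sI-A)^{-1}B+D$ and $\tilde G(s)=\tilde C(sI-\tilde A)^{-1}\tilde B+\tilde D$ be their transfer functions. Assume that both systems are * passive: there is a storage function $\mathcal H\colon\mathbb R^n\to[0,\infty)$ with $\mathcal H(x(t_1))-\mathcal H(x(t_0))\le\int_{t_0}^{t_1}y(\tau)^\top u(\tau)\,d\tau$ for all $t_0\le t_1$ and all trajectories $(u,x,y)$ of the system (on $\mathbb R$, with continuous input $u$); * minimal: $\operatorname{rank}[sI-A,\ B]=n=\operatorname{rank}[sI-A^\top,\ C^\top]$ for all $s\in\mathbb C$; * asymptotically stable: all eigenvalues of $A$ have negative real part (with $r$ and the matrices of $\tilde\Sigma$ in place of $n$ and those of $\Sigma$ for the second system). Let $\Sigma_H=(A,B,L,M)$ be a spectral factor of $\Sigma$, that is, $L\in\mathbb R^{k\times n}$,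 $M\in\mathbb R^{k\times m}$ and there is a symmetric positive semidefinite $X\in\mathbb R^{n\times n}$ with $$\begin{bmatrix}-A^\top X-XA & C^\top-XB\\ C-B^\top X & D+D^\top\end{bmatrix}=\begin{bmatrix}L^\top\\ M^\top\end{bmatrix}\begin{bmatrix}L& M\end{bmatrix},$$ and let $\Sigma_{\tilde H}=(\tilde A,\tilde B,\tilde L,\tilde M)$ be a spectral factor of $\tilde\Sigma$ in the same sense, with the same number $k$ of outputs. Let $H(s)=L(sI-A)^{-1}B+M$ and $\tilde H(s)=\tilde L(sI-\tilde A)^{-1}\tilde B+\tilde M$ be their transfer functions. For matrix-valued functions put $\|F\|_{\mathcal H_2}=\big(\sup_{\sigma>0}\int_{-\infty}^\infty\|F(\sigma+i\omega)\|_{\mathrm F}^2\,d\omega\big)^{1/2}$, where $\|\cdot\|_{\mathrm F}$ is the Frobenius norm, let $\mathcal H_2$ be the set of the $F$ that are analytic on the open right half plane with $\|F\|_{\mathcal H_2}<\infty$, and put $\|F\|_{L^\infty(i\mathbb R)}=\operatorname{ess\,sup}_{\omega\in\mathbb R}\|F(i\omega)\|_2$, where $\|\cdot\|_2$ is the spectral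 norm. If $G-\tilde G\in\mathcal H_2$ and $H-\tilde H\in\mathcal H_2$, then $H^\top(-\,\cdot\,)$ and $\tilde H$ belong to $L^\infty(i\mathbb R)$, and $$\|G-\tilde G\|_{\mathcal H_2}\le c(H,\tilde H)\,\|H-\tilde H\|_{\mathcal H_2},\qquad c(H,\tilde H)=\tfrac1{\sqrt2}\big(\|H^\top(-\,\cdot\,)\|_{L^\infty(i\mathbb R)}+\|\tilde H\|_{L^\infty(i\mathbb R)}\big).$$ -/

import Mathlib

open MeasureTheory Matrix
open scoped NNReal ENNReal

noncomputable section

/-- A real linear time-invariant system `x' = A x + B u`, `y = C x + D u` with `n` states,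
`m` inputs and `p` outputs. -/
structure LTISystem (n m p : ℕ) where
  A : Matrix (Fin n) (Fin n) ℝ
  B : Matrix (Fin n) (Fin m) ℝ
  C : Matrix (Fin p) (Fin n) ℝ
  D : Matrix (Fin p) (Fin m) ℝ

/-- A real matrix regarded as a complex matrix. -/
abbrev Matrix.toComplex {p q : ℕ} (M : Matrix (Fin p) (Fin q) ℝ) : Matrix (Fin p) (Fin q) ℂ :=
  M.map Complex.ofReal

namespace LTISystem

variable {n m p k : ℕ}

/-- The transfer function `s ↦ C (s I - A)⁻¹ B + D` (meaningful for `s` off the spectrum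
of `A`). -/
def transferFunction (S : LTISystem n m p) (s : ℂ) : Matrix (Fin p) (Fin m) ℂ :=
  S.C.toComplex * (s • (1 : Matrix (Fin n) (Fin n) ℂ) - S.A.toComplex)⁻¹ * S.B.toComplex
    + S.D.toComplex

/-- `(u, x, y)` is a trajectory of the system: the input is continuous, the state solves the
differential equation on the whole time axis with `x 0 = 0`, and `y` is the output. -/
structure IsTrajectory (S : LTISystem n m p) (u : ℝ → Fin m → ℝ) (x : ℝ → Fin n → ℝ)
    (y : ℝ → Fin p → ℝ) : Prop where
  continuous_input : Continuous u
  initial : x 0 = 0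
  state : ∀ t, HasDerivAt x (S.A *ᵥ x t + S.B *ᵥ u t) t
  output : ∀ t, y t = S.C *ᵥ x t + S.D *ᵥ u t

/-- Passivity: there is a nonnegative storage function of the state that satisfies the
dissipation inequality along all trajectories. -/
def IsPassive (S : LTISystem n m m) : Prop :=
  ∃ storage : (Fin n → ℝ) → ℝ≥0,
    ∀ (u : ℝ → Fin m → ℝ) (x : ℝ → Fin n → ℝ) (y : ℝ → Fin m → ℝ), S.IsTrajectory u x y →
      ∀ t₀ t₁ : ℝ, t₀ ≤ t₁ →
        (storage (x t₁) : ℝ) - (storage (x t₀) : ℝ) ≤ ∫ τ in t₀..t₁, y τ ⬝ᵥ u τ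

/-- Minimality: `rank [s I - A, B] = n = rank [s I - Aᵀ, Cᵀ]` for all complex `s`. -/
def IsMinimal (S : LTISystem n m p) : Prop :=
  ∀ s : ℂ,
    (fromCols (s • (1 : Matrix (Fin n) (Fin n) ℂ) - S.A.toComplex) S.B.toComplex).rank = n ∧
    (fromCols (s • (1 : Matrix (Fin n) (Fin n) ℂ) - S.A.toComplexᵀ) S.C.toComplexᵀ).rank = n

/-- Asymptotic stability: all complex eigenvalues of `A` lie in the open left half plane. -/
def IsAsymptoticallyStable (S : LTISystem n m p) : Prop :=
  ∀ s ∈ spectrum ℂ S.A.toComplex, s.re < 0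

/-- The matrix `W(X) = [-Aᵀ X - X A, Cᵀ - X B; C - Bᵀ X, D + Dᵀ]` of the
Kalman-Yakubovich-Popov inequality `W(X) ≥ 0`. -/
def kypMatrix (S : LTISystem n m m) (X : Matrix (Fin n) (Fin n) ℝ) :
    Matrix (Fin n ⊕ Fin m) (Fin n ⊕ Fin m) ℝ :=
  fromBlocks (-(S.Aᵀ * X) - X * S.A) (S.Cᵀ - X * S.B) (S.C - S.Bᵀ * X) (S.D + S.Dᵀ)

/-- `SH = (A, B, L, M)` is a spectral factor of `S = (A, B, C, D)`: for some symmetric positive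
semidefinite `X` one has `W(X) = [L, M]ᵀ [L, M]` (so `X` solves the KYP inequality). -/
def IsSpectralFactor (S : LTISystem n m m) (SH : LTISystem n m k) : Prop :=
  SH.A = S.A ∧ SH.B = S.B ∧
    ∃ X : Matrix (Fin n) (Fin n) ℝ, X.PosSemidef ∧
      S.kypMatrix X = (fromCols SH.C SH.D)ᵀ * fromCols SH.C SH.D

end LTISystem

section HardySpace

variable {p m : ℕ}

open scoped Matrix.Norms.Frobenius in
/-- The `H₂` norm `(sup_{σ > 0} ∫ ‖F(σ + iω)‖_F² dω)^{1/2}` over the open right half plane,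
as an extended nonnegative number. -/
def h2Norm (F : ℂ → Matrix (Fin p) (Fin m) ℂ) : ℝ≥0∞ :=
  (⨆ (σ : ℝ) (_ : 0 < σ), ∫⁻ ω : ℝ, ‖F (σ + Complex.I * ω)‖ₑ ^ 2) ^ (1 / 2 : ℝ)

open scoped Matrix.Norms.Frobenius in
/-- Membership in `H₂` of the open right half plane. -/
def MemH2 (F : ℂ → Matrix (Fin p) (Fin m) ℂ) : Prop :=
  AnalyticOnNhd ℂ F {s : ℂ | 0 < s.re} ∧ h2Norm F < ∞

open scoped Matrix.Norms.L2Operator in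
/-- The `L∞` norm on the imaginary axis: the essential supremum of the spectral norm
`‖F(iω)‖₂`, as an extended nonnegative number. -/
def linftyNorm (F : ℂ → Matrix (Fin p) (Fin m) ℂ) : ℝ≥0∞ :=
  eLpNorm (fun ω : ℝ => F (Complex.I * ω)) ∞ volume

open scoped Matrix.Norms.L2Operator in
/-- Membership in `L∞` of the imaginary axis. -/
def MemLinfty (F : ℂ → Matrix (Fin p) (Fin m) ℂ) : Prop :=
  MemLp (fun ω : ℝ => F (Complex.I * ω)) ∞ volume

end HardySpace

/-- The constant `c(H, H') = (‖Hᵀ(-·)‖_{L∞(iℝ)} + ‖H'‖_{L∞(iℝ)}) / √2`. -/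
def spectralFactorConstant {p m : ℕ} (H H' : ℂ → Matrix (Fin p) (Fin m) ℂ) : ℝ≥0∞ :=
  (linftyNorm (fun s => (H (-s))ᵀ) + linftyNorm H') / ENNReal.ofReal (Real.sqrt 2)

end

/-! ### Scalar functions on the right half plane: contour shifts and square means on vertical lines.
-/

section HalfPlane

open Filter Topology

/-! Put E = G - G̃ and F = H - H̃. On the imaginary axis the KYP equation gives G + Gᴴ = Hᴴ H, and
likewise for the second system (`transferFunction_add_conjTranspose`). Subtracting, E + Eᴴ = Hᴴ H -
H̃ᴴ H̃ = Hᴴ F + Fᴴ H̃, so pointwise ‖E + Eᴴ‖_F ≤ γ ‖F‖_F almost everywhere, where γ = √2 c(H, H̃).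

The factor 1/√2 comes from orthogonality. Since E lies in H₂, the feedthrough terms of G and G̃
agree (`feedthrough_eq_of_memH2_sub`), so E is stable and strictly proper. The cross terms of ‖E +
Eᴴ‖_F² are real parts of E_ij E_ji, products without conjugates: they are holomorphic on the closed
right half plane and O(|s|⁻²), so pushing the contour to the right makes their integrals vanish
(`integral_mul_eq_zero`). Hence ∫ ‖E + Eᴴ‖_F² = 2 ∫ ‖E‖_F² on the axis.

The H₂ norm is a supremum over vertical lines inside the half plane, so each side must be compared
with its integral on the axis. For E the axis integral must dominate; this is a reflection argument
(`integral_sq_le_average`, `integral_sq_le`). For F the opposite inequality is needed, and it is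
Fatou's lemma (`lintegral_imaginaryAxis_le_h2Norm`). -/

theorem Complex.sq_norm_add_I_mul (x y : ℝ) : ‖(x : ℂ) + Complex.I * y‖ ^ 2 = x ^ 2 + y ^ 2 := by
  rw [← Complex.normSq_eq_norm_sq, Complex.normSq_apply]; simp; ring

/-- Integrals over vertical lines agree when the integrand is holomorphic on the closed strip
between the lines and decays quadratically. -/
theorem integral_vertical_eq_of_strip {h : ℂ → ℂ} {a b K : ℝ} (hab : a ≤ b)
    (hd : ∀ s : ℂ, a ≤ s.re → s.re ≤ b → DifferentiableAt ℂ h s)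
    (hK : ∀ x y : ℝ, a ≤ x → x ≤ b → ‖h (x + Complex.I * y)‖ ≤ K * (1 + y ^ 2)⁻¹) :
    ∫ ω : ℝ, h (a + Complex.I * ω) = ∫ ω : ℝ, h (b + Complex.I * ω) := by
  have hint : ∀ x : ℝ, a ≤ x → x ≤ b → Integrable (fun ω : ℝ => h (x + Complex.I * ω)) := by
    intro x hx hx'
    refine (integrable_inv_one_add_sq.const_mul K).mono' (Continuous.aestronglyMeasurable ?_)
      (Eventually.of_forall fun y => hK x y hx hx')
    rw [continuous_iff_continuousAt]
    intro y
    refine ContinuousAt.comp (f := fun ω : ℝ => (x : ℂ) + Complex.I * ω)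
      (hd _ (by simpa using hx) (by simpa using hx')).continuousAt (by fun_prop)
  -- Cauchy's theorem on the rectangle [a, b] × [-R, R]: the vertical sides differ by the two
  -- horizontal sides, which vanish as R → ∞.
  have hrect : ∀ R : ℝ, ‖(∫ y in (-R)..R, h (b + Complex.I * y)) -
      ∫ y in (-R)..R, h (a + Complex.I * y)‖ ≤ 2 * (K * (1 + R ^ 2)⁻¹ * |b - a|) := by
    intro R
    have key := Complex.integral_boundary_rect_eq_zero_of_differentiableOn h
      ⟨a, -R⟩ ⟨b, R⟩ (by
        intro s hs
        rw [Complex.mem_reProdIm, Set.uIcc_of_le hab] at hs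
        exact (hd s hs.1.1 hs.1.2).differentiableWithinAt)
    simp only [smul_eq_mul, mul_comm _ Complex.I] at key
    have hside : ∀ c : ℝ, c ^ 2 = R ^ 2 →
        ‖∫ x in a..b, h (x + Complex.I * c)‖ ≤ K * (1 + R ^ 2)⁻¹ * |b - a| := by
      intro c hc
      refine intervalIntegral.norm_integral_le_of_norm_le_const fun x hx => ?_
      rw [Set.uIoc_of_le hab] at hx
      simpa [hc] using hK x c hx.1.le hx.2
    have h1 := hside (-R) (by ring)
    have h2 := hside R rfl
    have e : Complex.I * ((∫ y in (-R)..R, h (b + Complex.I * y)) -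
        ∫ y in (-R)..R, h (a + Complex.I * y)) =
        (∫ x in a..b, h (x + Complex.I * R)) - ∫ x in a..b, h (x + Complex.I * (-R : ℝ)) := by
      linear_combination key
    calc _ = ‖Complex.I * ((∫ y in (-R)..R, h (b + Complex.I * y)) -
        ∫ y in (-R)..R, h (a + Complex.I * y))‖ := by simp
      _ ≤ _ := by rw [e]; exact (norm_sub_le _ _).trans (by linarith)
  have hlim : Tendsto (fun R : ℝ => (∫ y in (-R)..R, h (b + Complex.I * y)) -
      ∫ y in (-R)..R, h (a + Complex.I * y)) atTop
      (𝓝 ((∫ ω : ℝ, h (b + Complex.I * ω)) - ∫ ω : ℝ, h (a + Complex.I * ω))) :=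
    (intervalIntegral_tendsto_integral (hint b hab le_rfl) tendsto_neg_atTop_atBot tendsto_id).sub
      (intervalIntegral_tendsto_integral (hint a le_rfl hab) tendsto_neg_atTop_atBot tendsto_id)
  have hlim0 : Tendsto (fun R : ℝ => 2 * (K * (1 + R ^ 2)⁻¹ * |b - a|)) atTop (𝓝 0) := by
    have : Tendsto (fun R : ℝ => (1 + R ^ 2)⁻¹) atTop (𝓝 0) :=
      tendsto_inv_atTop_zero.comp
        (tendsto_atTop_add_const_left _ _ (tendsto_pow_atTop two_ne_zero))
    simpa using ((this.const_mul K).mul_const |b - a|).const_mul 2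
  exact (sub_eq_zero.1 (tendsto_nhds_unique hlim (squeeze_zero_norm hrect hlim0))).symm

/-- Functions holomorphic on the closed right half plane that decay like `1 / ‖s‖`, such as
the strictly proper stable rational functions. -/
structure DecaysOnRightHalfPlane (f : ℂ → ℂ) : Prop where
  differentiableAt : ∀ s : ℂ, 0 ≤ s.re → DifferentiableAt ℂ f s
  bound : ∃ K : ℝ, ∀ s : ℂ, 0 ≤ s.re → ‖f s‖ ^ 2 ≤ K * (1 + ‖s‖ ^ 2)⁻¹

namespace DecaysOnRightHalfPlane

variable {f g : ℂ → ℂ}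

theorem exists_bound (hf : DecaysOnRightHalfPlane f) : ∃ K : ℝ, 0 ≤ K ∧ ∀ x y : ℝ, 0 ≤ x →
    ‖f (x + Complex.I * y)‖ ^ 2 ≤ K * (1 + (x ^ 2 + y ^ 2))⁻¹ := by
  obtain ⟨K, hK⟩ := hf.bound
  refine ⟨K, ?_, fun x y hx => ?_⟩
  · simpa using (sq_nonneg _).trans (hK 0 le_rfl)
  · simpa [Complex.sq_norm_add_I_mul] using hK (x + Complex.I * y) (by simpa using hx)

theorem exists_bound_im (hf : DecaysOnRightHalfPlane f) : ∃ K : ℝ, 0 ≤ K ∧ ∀ x y : ℝ, 0 ≤ x →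
    ‖f (x + Complex.I * y)‖ ^ 2 ≤ K * (1 + y ^ 2)⁻¹ := by
  obtain ⟨K, hK0, hK⟩ := hf.exists_bound
  refine ⟨K, hK0, fun x y hx => (hK x y hx).trans ?_⟩
  gcongr
  nlinarith [sq_nonneg x]

theorem continuous_vertical (hf : DecaysOnRightHalfPlane f) {x : ℝ} (hx : 0 ≤ x) :
    Continuous fun ω : ℝ => f (x + Complex.I * ω) := by
  rw [continuous_iff_continuousAt]
  intro y
  exact ContinuousAt.comp (f := fun ω : ℝ => (x : ℂ) + Complex.I * ω)
    (hf.differentiableAt _ (by simpa using hx)).continuousAt (by fun_prop)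

theorem integrable_sq (hf : DecaysOnRightHalfPlane f) {x : ℝ} (hx : 0 ≤ x) :
    Integrable fun ω : ℝ => ‖f (x + Complex.I * ω)‖ ^ 2 := by
  obtain ⟨K, -, hK⟩ := hf.exists_bound_im
  refine (integrable_inv_one_add_sq.const_mul K).mono'
    ((hf.continuous_vertical hx).norm.pow 2).aestronglyMeasurable
    (Eventually.of_forall fun y => ?_)
  simpa using hK x y hx

theorem add (hf : DecaysOnRightHalfPlane f) (hg : DecaysOnRightHalfPlane g) :
    DecaysOnRightHalfPlane (f + g) := by
  obtain ⟨K, hK⟩ := hf.bound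
  obtain ⟨K', hK'⟩ := hg.bound
  refine ⟨fun s hs => (hf.differentiableAt s hs).add (hg.differentiableAt s hs),
    2 * (K + K'), fun s hs => ?_⟩
  have h := norm_add_le (f s) (g s)
  have : ‖f s + g s‖ ^ 2 ≤ (‖f s‖ + ‖g s‖) ^ 2 := by gcongr
  simp only [Pi.add_apply]
  nlinarith [hK s hs, hK' s hs, sq_nonneg (‖f s‖ - ‖g s‖)]

theorem const_mul (hf : DecaysOnRightHalfPlane f) (c : ℂ) :
    DecaysOnRightHalfPlane fun s => c * f s := by
  obtain ⟨K, hK⟩ := hf.bound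
  refine ⟨fun s hs => (hf.differentiableAt s hs).const_mul c, ‖c‖ ^ 2 * K, fun s hs => ?_⟩
  rw [norm_mul, mul_pow, mul_assoc]
  gcongr
  exact hK s hs

theorem zero : DecaysOnRightHalfPlane fun _ => 0 :=
  ⟨fun _ _ => differentiableAt_const _, 0, by simp⟩

theorem sum {ι : Type*} {t : Finset ι} {F : ι → ℂ → ℂ}
    (hF : ∀ i ∈ t, DecaysOnRightHalfPlane (F i)) :
    DecaysOnRightHalfPlane fun s => ∑ i ∈ t, F i s := by
  classical
  induction t using Finset.induction_on with
  | empty => simpa using zero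
  | insert i t hi ih =>
    simp only [Finset.sum_insert hi]
    exact (hF i (by simp)).add (ih fun j hj => hF j (by simp [hj]))

/-- Schwarz reflection keeps the class. -/
theorem reflect (hf : DecaysOnRightHalfPlane f) :
    DecaysOnRightHalfPlane fun s => starRingEnd ℂ (f (starRingEnd ℂ s)) := by
  obtain ⟨K, hK⟩ := hf.bound
  refine ⟨fun s hs => ?_, K, fun s hs => ?_⟩
  · have := (hf.differentiableAt (starRingEnd ℂ s) (by simpa using hs)).conj_conj
    simpa [Function.comp_def] using this
  · simpa using hK (starRingEnd ℂ s) (by simpa using hs)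

theorem norm_mul_le_of_sq {a b : ℂ} {u v : ℝ} (ha : ‖a‖ ^ 2 ≤ u) (hb : ‖b‖ ^ 2 ≤ v) :
    ‖a * b‖ ≤ (u + v) / 2 := by
  rw [norm_mul]; nlinarith [sq_nonneg (‖a‖ - ‖b‖)]

/-- The product is holomorphic and O(|s|⁻²), so its integral is the same over every line Re s = b ≥
0, and it tends to zero as b → ∞. -/
theorem integral_mul_eq_zero (hf : DecaysOnRightHalfPlane f) (hg : DecaysOnRightHalfPlane g) :
    ∫ ω : ℝ, f (Complex.I * ω) * g (Complex.I * ω) = 0 := by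
  obtain ⟨K, hK0, hK⟩ := hf.exists_bound
  obtain ⟨K', hK0', hK'⟩ := hg.exists_bound
  have hb : ∀ x y : ℝ, 0 ≤ x → ‖f (x + Complex.I * y) * g (x + Complex.I * y)‖ ≤
      (K + K') / 2 * (1 + (x ^ 2 + y ^ 2))⁻¹ := fun x y hx =>
    (norm_mul_le_of_sq (hK x y hx) (hK' x y hx)).trans_eq (by ring)
  -- `hb` forces pointwise decay as x → ∞; this weaker bound, uniform in x, is the integrable
  -- majorant for the shift and for dominated convergence.
  have hb' : ∀ x y : ℝ, 0 ≤ x → ‖f (x + Complex.I * y) * g (x + Complex.I * y)‖ ≤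
      (K + K') / 2 * (1 + y ^ 2)⁻¹ := by
    intro x y hx
    refine (hb x y hx).trans ?_
    gcongr
    nlinarith [sq_nonneg x]
  have hshift : ∀ b : ℝ, 0 ≤ b → ∫ ω : ℝ, f (Complex.I * ω) * g (Complex.I * ω) =
      ∫ ω : ℝ, f (b + Complex.I * ω) * g (b + Complex.I * ω) := by
    intro b hb0
    have := integral_vertical_eq_of_strip (h := fun s => f s * g s) hb0
      (fun s hs _ => (hf.differentiableAt s hs).mul (hg.differentiableAt s hs))
      (fun x y hx _ => hb' x y hx)
    simpa using this
  have hlim : Tendsto (fun b : ℝ => ∫ ω : ℝ, f (b + Complex.I * ω) * g (b + Complex.I * ω))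
      atTop (𝓝 (∫ _ : ℝ, (0 : ℂ))) := by
    refine tendsto_integral_filter_of_dominated_convergence
      (fun y => (K + K') / 2 * (1 + y ^ 2)⁻¹) ?_ ?_ (integrable_inv_one_add_sq.const_mul _) ?_
    · filter_upwards [eventually_ge_atTop 0] with b hb0
      exact ((hf.continuous_vertical hb0).mul (hg.continuous_vertical hb0)).aestronglyMeasurable
    · filter_upwards [eventually_ge_atTop 0] with b hb0
      exact Eventually.of_forall fun y => hb' b y hb0
    · refine Eventually.of_forall fun y => ?_
      have h0 : Tendsto (fun b : ℝ => (K + K') / 2 * (1 + (b ^ 2 + y ^ 2))⁻¹) atTop (𝓝 0) := by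
        have : Tendsto (fun b : ℝ => (1 + (b ^ 2 + y ^ 2))⁻¹) atTop (𝓝 0) :=
          tendsto_inv_atTop_zero.comp (tendsto_atTop_add_const_left _ _
            (tendsto_atTop_add_const_right _ _ (tendsto_pow_atTop two_ne_zero)))
        simpa using this.const_mul ((K + K') / 2)
      refine squeeze_zero_norm' ?_ h0
      filter_upwards [eventually_ge_atTop 0] with b hb0 using hb b y hb0
  refine tendsto_nhds_unique (tendsto_const_nhds.congr' ?_) (by simpa using hlim)
  filter_upwards [eventually_ge_atTop 0] with b hb0 using hshift b hb0

/-- The square integral over a vertical line is at most the average of those over the imaginary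
axis and over the line twice as far to the right. -/
theorem integral_sq_le_average (hf : DecaysOnRightHalfPlane f) {σ : ℝ} (hσ : 0 ≤ σ) :
    ∫ ω : ℝ, ‖f (σ + Complex.I * ω)‖ ^ 2 ≤
      ((∫ ω : ℝ, ‖f ((2 * σ : ℝ) + Complex.I * ω)‖ ^ 2) +
        ∫ ω : ℝ, ‖f (Complex.I * ω)‖ ^ 2) / 2 := by
  obtain ⟨K, hK0, hK⟩ := hf.exists_bound_im
  have hr := hf.reflect
  -- The reflection s ↦ 2σ - conj s fixes the line Re s = σ and exchanges Re s = 0 with Re s = 2σ.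
  -- So h is holomorphic on the strip 0 ≤ Re s ≤ σ, equals |f|² on Re s = σ, and on the axis is a
  -- product of values of f on the two outer lines, which AM-GM bounds by their average.
  set h : ℂ → ℂ := fun s => starRingEnd ℂ (f (starRingEnd ℂ ((2 * σ : ℝ) - s))) * f s with hh
  have hconj : ∀ x y : ℝ, h (x + Complex.I * y) =
      starRingEnd ℂ (f ((2 * σ - x : ℝ) + Complex.I * y)) * f (x + Complex.I * y) := by
    intro x y
    simp only [hh]
    congr 3
    simp [Complex.conj_ofNat]
    ring
  have hI : ∫ ω : ℝ, h ((0 : ℝ) + Complex.I * ω) = ∫ ω : ℝ, h (σ + Complex.I * ω) := by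
    refine integral_vertical_eq_of_strip (K := K) hσ (fun s hs hs' => ?_) (fun x y hx hx' => ?_)
    · refine DifferentiableAt.mul ?_ (hf.differentiableAt s hs)
      exact DifferentiableAt.comp s (f := fun s => ((2 * σ : ℝ) : ℂ) - s)
        (hr.differentiableAt _ (by simp; linarith)) (by fun_prop)
    · rw [hconj]
      refine (norm_mul_le_of_sq (u := K * (1 + y ^ 2)⁻¹) ?_ (hK x y hx)).trans_eq (by ring)
      rw [RCLike.norm_conj]
      exact hK _ y (by linarith)
  have e1 : ∫ ω : ℝ, h (σ + Complex.I * ω) =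
      ((∫ ω : ℝ, ‖f (σ + Complex.I * ω)‖ ^ 2 : ℝ) : ℂ) := by
    rw [← integral_complex_ofReal]
    refine integral_congr_ae (Eventually.of_forall fun y => ?_)
    simp only [hconj, two_mul, add_sub_cancel_right]
    rw [mul_comm, Complex.mul_conj, Complex.normSq_eq_norm_sq]
  have e2 : ∫ ω : ℝ, ‖f (σ + Complex.I * ω)‖ ^ 2 ≤ ∫ ω : ℝ, ‖h ((0 : ℝ) + Complex.I * ω)‖ := by
    refine le_trans ?_ (norm_integral_le_integral_norm _)
    rw [hI, e1, Complex.norm_real]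
    exact le_abs_self _
  have i2 := hf.integrable_sq (x := 2 * σ) (by linarith)
  have i0 : Integrable fun ω : ℝ => ‖f (Complex.I * ω)‖ ^ 2 := by
    simpa using hf.integrable_sq le_rfl
  refine e2.trans ?_
  rw [← integral_add i2 i0, ← integral_div]
  refine integral_mono_of_nonneg (Eventually.of_forall fun _ => norm_nonneg _)
    ((i2.add i0).div_const 2) (Eventually.of_forall fun y => ?_)
  simp only [hconj]
  refine (norm_mul_le_of_sq (u := ‖f ((2 * σ : ℝ) + Complex.I * y)‖ ^ 2) ?_ le_rfl).trans_eq ?_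
  · rw [RCLike.norm_conj]; simp
  · simp

/-- If N is the supremum of the square means over all lines Re s ≥ 0 and N₀ is the one on the axis,
the averaging inequality gives N ≤ (N + N₀) / 2. As N is finite by the decay bound, N ≤ N₀. -/
theorem integral_sq_le (hf : DecaysOnRightHalfPlane f) {σ : ℝ} (hσ : 0 ≤ σ) :
    ∫ ω : ℝ, ‖f (σ + Complex.I * ω)‖ ^ 2 ≤ ∫ ω : ℝ, ‖f (Complex.I * ω)‖ ^ 2 := by
  obtain ⟨K, hK0, hK⟩ := hf.exists_bound_im
  set N : Set.Ici (0 : ℝ) → ℝ := fun σ => ∫ ω : ℝ, ‖f ((σ : ℝ) + Complex.I * ω)‖ ^ 2 with hN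
  have hbdd : BddAbove (Set.range N) := by
    refine ⟨∫ y : ℝ, K * (1 + y ^ 2)⁻¹, ?_⟩
    rintro _ ⟨x, rfl⟩
    exact integral_mono (hf.integrable_sq x.2) (integrable_inv_one_add_sq.const_mul K)
      fun y => hK _ y x.2
  have hle : (⨆ x, N x) ≤ ((⨆ x, N x) + ∫ ω : ℝ, ‖f (Complex.I * ω)‖ ^ 2) / 2 := by
    have : Nonempty (Set.Ici (0 : ℝ)) := ⟨⟨0, Set.self_mem_Ici⟩⟩
    refine ciSup_le fun x => (hf.integral_sq_le_average x.2).trans ?_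
    have := le_ciSup hbdd ⟨2 * (x : ℝ), Set.mem_Ici.2 (mul_nonneg zero_le_two x.2)⟩
    simp only [hN] at this ⊢
    linarith
  have := le_ciSup hbdd ⟨σ, hσ⟩
  simp only [hN] at this hle ⊢
  linarith

end DecaysOnRightHalfPlane

end HalfPlane

/-! ### Frobenius and spectral norms, and H₂ norms against integrals on the imaginary axis. -/

section MatrixNorms

open Filter Topology

variable {p q l : ℕ}

open scoped Matrix.Norms.Frobenius in
/-- The Frobenius norm as an extended nonnegative number. -/
noncomputable def frobeniusENorm (M : Matrix (Fin p) (Fin q) ℂ) : ℝ≥0∞ := ‖M‖ₑ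

open scoped Matrix.Norms.L2Operator in
/-- The spectral norm as an extended nonnegative number. -/
noncomputable def spectralENorm (M : Matrix (Fin p) (Fin q) ℂ) : ℝ≥0∞ := ‖M‖ₑ

/-- The bridge from the matrix norm to the scalar half-plane lemmas, which then apply entry by
entry. -/
theorem frobeniusENorm_sq (M : Matrix (Fin p) (Fin q) ℂ) :
    frobeniusENorm M ^ 2 = ENNReal.ofReal (∑ i, ∑ j, ‖M i j‖ ^ 2) := by
  let _ : NormedAddCommGroup (Matrix (Fin p) (Fin q) ℂ) := Matrix.frobeniusNormedAddCommGroup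
  have h : ‖M‖ ^ 2 = ∑ i, ∑ j, ‖M i j‖ ^ 2 := by
    rw [frobenius_norm_def, ← Real.sqrt_eq_rpow, Real.sq_sqrt]
    · simp
    · positivity
  rw [← h, ENNReal.ofReal_pow (norm_nonneg _), ofReal_norm]
  rfl

theorem frobeniusENorm_conjTranspose (M : Matrix (Fin p) (Fin q) ℂ) :
    frobeniusENorm Mᴴ = frobeniusENorm M := by
  rw [← (ENNReal.pow_right_strictMono two_ne_zero).injective.eq_iff]
  rw [frobeniusENorm_sq, frobeniusENorm_sq, Finset.sum_comm]
  simp [conjTranspose_apply]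

theorem spectralENorm_conjTranspose (M : Matrix (Fin p) (Fin q) ℂ) :
    spectralENorm Mᴴ = spectralENorm M := by
  open scoped Matrix.Norms.L2Operator in
  have := l2_opNorm_conjTranspose M
  simp only [spectralENorm, ← ofReal_norm, this]

/-- Each column of M N is M applied to a column of N, and the squared Frobenius norm is the sum of
the squared Euclidean norms of the columns. -/
theorem frobeniusENorm_mul_le_left (M : Matrix (Fin p) (Fin q) ℂ) (N : Matrix (Fin q) (Fin l) ℂ) :
    frobeniusENorm (M * N) ≤ spectralENorm M * frobeniusENorm N := by
  open scoped Matrix.Norms.L2Operator in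
  rw [← ENNReal.pow_le_pow_left_iff two_ne_zero, mul_pow, frobeniusENorm_sq, frobeniusENorm_sq,
    spectralENorm, ← ofReal_norm, ← ENNReal.ofReal_pow (norm_nonneg _),
    ← ENNReal.ofReal_mul (by positivity)]
  refine ENNReal.ofReal_le_ofReal ?_
  rw [Finset.sum_comm, Finset.sum_comm (s := (Finset.univ : Finset (Fin q))), Finset.mul_sum]
  refine Finset.sum_le_sum fun j _ => ?_
  have h := l2_opNorm_mulVec M (WithLp.toLp 2 fun a => N a j)
  have h2 := pow_le_pow_left₀ (norm_nonneg _) h 2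
  rw [mul_pow, EuclideanSpace.norm_sq_eq, EuclideanSpace.norm_sq_eq] at h2
  simpa [Matrix.mul_apply, mulVec, dotProduct] using h2

theorem frobeniusENorm_mul_le_right (M : Matrix (Fin p) (Fin q) ℂ) (N : Matrix (Fin q) (Fin l) ℂ) :
    frobeniusENorm (M * N) ≤ spectralENorm N * frobeniusENorm M := by
  rw [← frobeniusENorm_conjTranspose, conjTranspose_mul]
  refine (frobeniusENorm_mul_le_left _ _).trans_eq ?_
  rw [frobeniusENorm_conjTranspose, spectralENorm_conjTranspose]

theorem lintegral_frobeniusENorm_sq {F : ℝ → Matrix (Fin p) (Fin q) ℂ}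
    (hF : ∀ i j, Integrable fun ω => ‖F ω i j‖ ^ 2) :
    ∫⁻ ω, frobeniusENorm (F ω) ^ 2 = ENNReal.ofReal (∑ i, ∑ j, ∫ ω, ‖F ω i j‖ ^ 2) := by
  simp only [frobeniusENorm_sq]
  rw [← ofReal_integral_eq_lintegral_ofReal
    (integrable_finsetSum _ fun i _ => integrable_finsetSum _ fun j _ => hF i j)
    (Eventually.of_forall fun ω => by positivity)]
  rw [integral_finsetSum _ fun i _ => integrable_finsetSum _ fun j _ => hF i j]
  congr 2
  ext i
  rw [integral_finsetSum _ fun j _ => hF i j]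

theorem h2Norm_eq (F : ℂ → Matrix (Fin p) (Fin q) ℂ) :
    h2Norm F = (⨆ (σ : ℝ) (_ : 0 < σ), ∫⁻ ω : ℝ, frobeniusENorm (F (σ + Complex.I * ω)) ^ 2) ^
      (1 / 2 : ℝ) := rfl

theorem continuous_frobeniusENorm :
    Continuous (frobeniusENorm : Matrix (Fin p) (Fin q) ℂ → ℝ≥0∞) := by
  have h : (frobeniusENorm : Matrix (Fin p) (Fin q) ℂ → ℝ≥0∞) =
      fun M => (ENNReal.ofReal (∑ i, ∑ j, ‖M i j‖ ^ 2)) ^ (1 / 2 : ℝ) := by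
    ext M
    rw [← frobeniusENorm_sq, ← ENNReal.rpow_natCast, ← ENNReal.rpow_mul]
    simp
  rw [h]
  refine ENNReal.continuous_rpow_const.comp (ENNReal.continuous_ofReal.comp ?_)
  exact continuous_finsetSum _ fun i _ => continuous_finsetSum _ fun j _ =>
    ((continuous_id.matrix_elem i j).norm).pow 2

theorem frobeniusENorm_add_le (M N : Matrix (Fin p) (Fin q) ℂ) :
    frobeniusENorm (M + N) ≤ frobeniusENorm M + frobeniusENorm N := by
  open scoped Matrix.Norms.Frobenius in
  rw [frobeniusENorm, frobeniusENorm, frobeniusENorm, ← ofReal_norm, ← ofReal_norm, ← ofReal_norm,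
    ← ENNReal.ofReal_add (norm_nonneg _) (norm_nonneg _)]
  exact ENNReal.ofReal_le_ofReal (norm_add_le M N)

theorem enorm_entry_sq_le_frobeniusENorm (M : Matrix (Fin p) (Fin q) ℂ) (i : Fin p) (j : Fin q) :
    ‖M i j‖ₑ ^ 2 ≤ frobeniusENorm M ^ 2 := by
  rw [frobeniusENorm_sq, ← ofReal_norm, ← ENNReal.ofReal_pow (norm_nonneg _)]
  refine ENNReal.ofReal_le_ofReal ?_
  exact (Finset.single_le_sum (f := fun j => ‖M i j‖ ^ 2) (fun _ _ => by positivity)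
    (Finset.mem_univ j)).trans (Finset.single_le_sum (f := fun i => ∑ j, ‖M i j‖ ^ 2)
      (fun _ _ => by positivity) (Finset.mem_univ i))

/-- The square integral over the imaginary axis is at most the `H₂` norm. -/
theorem lintegral_imaginaryAxis_le_h2Norm {F : ℂ → Matrix (Fin p) (Fin q) ℂ}
    (hF : ∀ s : ℂ, 0 ≤ s.re → ContinuousAt F s) :
    (∫⁻ ω : ℝ, frobeniusENorm (F (Complex.I * ω)) ^ 2) ^ (1 / 2 : ℝ) ≤ h2Norm F := by
  rw [h2Norm_eq]
  refine ENNReal.rpow_le_rpow ?_ (by norm_num)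
  have hpos : ∀ n : ℕ, (0 : ℝ) < 1 / ((n : ℝ) + 1) := fun n => Nat.one_div_pos_of_nat
  have hmeas : ∀ σ : ℝ, 0 < σ → Measurable fun ω : ℝ =>
      frobeniusENorm (F (σ + Complex.I * ω)) ^ 2 := by
    intro σ hσ
    refine Continuous.measurable ((ENNReal.continuous_pow 2).comp
      (continuous_frobeniusENorm.comp (continuous_iff_continuousAt.2 fun y => ?_)))
    exact ContinuousAt.comp (f := fun ω : ℝ => (σ : ℂ) + Complex.I * ω)
      (hF _ (by simpa using hσ.le)) (by fun_prop)
  -- Fatou's lemma along the lines Re s = 1 / (n + 1), which approach the axis from inside the half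
  -- plane.
  calc ∫⁻ ω : ℝ, frobeniusENorm (F (Complex.I * ω)) ^ 2
      = ∫⁻ ω : ℝ, liminf (fun n : ℕ =>
          frobeniusENorm (F ((1 / ((n : ℝ) + 1) : ℝ) + Complex.I * ω)) ^ 2) atTop := by
        refine lintegral_congr fun y => (Tendsto.liminf_eq ?_).symm
        refine ((ENNReal.continuous_pow 2).tendsto _).comp
          ((continuous_frobeniusENorm.tendsto _).comp
            (Tendsto.comp (hF (Complex.I * y) (by simp)) ?_))
        have : Tendsto (fun n : ℕ => ((1 / ((n : ℝ) + 1) : ℝ) : ℂ) + Complex.I * y) atTop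
            (𝓝 (((0 : ℝ) : ℂ) + Complex.I * y)) :=
          ((Complex.continuous_ofReal.tendsto 0).comp
            tendsto_one_div_add_atTop_nhds_zero_nat).add_const _
        simpa using this
    _ ≤ liminf (fun n : ℕ => ∫⁻ ω : ℝ,
          frobeniusENorm (F ((1 / ((n : ℝ) + 1) : ℝ) + Complex.I * ω)) ^ 2) atTop :=
        lintegral_liminf_le fun n => hmeas _ (hpos n)
    _ ≤ ⨆ (σ : ℝ) (_ : 0 < σ), ∫⁻ ω : ℝ, frobeniusENorm (F (σ + Complex.I * ω)) ^ 2 := by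
        refine liminf_le_of_le (by isBoundedDefault) fun b hb => ?_
        obtain ⟨n, hn⟩ := hb.exists
        exact hn.trans (le_iSup₂_of_le (1 / ((n : ℝ) + 1)) (hpos n) le_rfl)

/-- The `H₂` norm is at most the square integral over the imaginary axis. -/
theorem h2Norm_le_lintegral_imaginaryAxis {F : ℂ → Matrix (Fin p) (Fin q) ℂ}
    (hF : ∀ i j, DecaysOnRightHalfPlane fun s => F s i j) :
    h2Norm F ≤ (∫⁻ ω : ℝ, frobeniusENorm (F (Complex.I * ω)) ^ 2) ^ (1 / 2 : ℝ) := by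
  rw [h2Norm_eq]
  refine ENNReal.rpow_le_rpow (iSup₂_le fun σ hσ => ?_) (by norm_num)
  rw [lintegral_frobeniusENorm_sq fun i j => (hF i j).integrable_sq hσ.le,
    lintegral_frobeniusENorm_sq fun i j => by simpa using (hF i j).integrable_sq le_rfl]
  exact ENNReal.ofReal_le_ofReal (Finset.sum_le_sum fun i _ => Finset.sum_le_sum fun j _ =>
    (hF i j).integral_sq_le hσ.le)

/-- A stable strictly proper function is orthogonal to its adjoint on the imaginary axis. -/
theorem lintegral_add_conjTranspose {F : ℂ → Matrix (Fin p) (Fin p) ℂ}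
    (hF : ∀ i j, DecaysOnRightHalfPlane fun s => F s i j) :
    ∫⁻ ω : ℝ, frobeniusENorm (F (Complex.I * ω) + (F (Complex.I * ω))ᴴ) ^ 2 =
      2 * ∫⁻ ω : ℝ, frobeniusENorm (F (Complex.I * ω)) ^ 2 := by
  have hsq : ∀ i j, Integrable fun ω : ℝ => ‖F (Complex.I * ω) i j‖ ^ 2 := fun i j => by
    simpa using (hF i j).integrable_sq le_rfl
  have hcont : ∀ i j, Continuous fun ω : ℝ => F (Complex.I * ω) i j := fun i j => by
    simpa using (hF i j).continuous_vertical le_rfl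
  have hmul : ∀ i j, Integrable fun ω : ℝ => F (Complex.I * ω) i j * F (Complex.I * ω) j i :=
    fun i j => (((hsq i j).add (hsq j i)).div_const 2).mono'
      ((hcont i j).mul (hcont j i)).aestronglyMeasurable
      (Eventually.of_forall fun _ => DecaysOnRightHalfPlane.norm_mul_le_of_sq le_rfl le_rfl)
  have hre : ∀ i j, Integrable fun ω : ℝ =>
      2 * (F (Complex.I * ω) i j * F (Complex.I * ω) j i).re := fun i j =>
    (hmul i j).re.const_mul 2
  -- The (j, i) entry enters conjugated, so the cross term contains the plain product of the two
  -- entries, which is holomorphic.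
  have hexp : ∀ i j, ∀ ω : ℝ, ‖(F (Complex.I * ω) + (F (Complex.I * ω))ᴴ) i j‖ ^ 2 =
      ‖F (Complex.I * ω) i j‖ ^ 2 + ‖F (Complex.I * ω) j i‖ ^ 2 +
        2 * (F (Complex.I * ω) i j * F (Complex.I * ω) j i).re := by
    intro i j ω
    simp only [Matrix.add_apply, conjTranspose_apply, ← Complex.normSq_eq_norm_sq,
      Complex.normSq_apply, Complex.add_re, Complex.add_im, Complex.mul_re, RCLike.star_def,
      Complex.conj_re, Complex.conj_im]
    ring
  have hint : ∀ i j, ∫ ω : ℝ, ‖(F (Complex.I * ω) + (F (Complex.I * ω))ᴴ) i j‖ ^ 2 =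
      (∫ ω : ℝ, ‖F (Complex.I * ω) i j‖ ^ 2) + ∫ ω : ℝ, ‖F (Complex.I * ω) j i‖ ^ 2 := by
    intro i j
    have h0 : ∫ ω : ℝ, (F (Complex.I * ω) i j * F (Complex.I * ω) j i).re = 0 := by
      have := integral_re (hmul i j)
      rw [(hF i j).integral_mul_eq_zero (hF j i)] at this
      simpa using this
    have h2 := integral_add (hsq i j) (hsq j i)
    have h3 := integral_add (f := fun ω : ℝ =>
      ‖F (Complex.I * ω) i j‖ ^ 2 + ‖F (Complex.I * ω) j i‖ ^ 2)
      ((hsq i j).add (hsq j i)) (hre i j)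
    rw [integral_congr_ae (Eventually.of_forall (hexp i j)), h3, h2, integral_const_mul, h0,
      mul_zero, add_zero]
  rw [lintegral_frobeniusENorm_sq hsq, lintegral_frobeniusENorm_sq fun i j => by
    simp only [hexp]; exact ((hsq i j).add (hsq j i)).add (hre i j)]
  simp only [hint, Finset.sum_add_distrib]
  rw [Finset.sum_comm (f := fun i j => ∫ ω : ℝ, ‖F (Complex.I * ω) j i‖ ^ 2), ← two_mul,
    ENNReal.ofReal_mul zero_le_two, ENNReal.ofReal_ofNat]

theorem ae_spectralENorm_le_linftyNorm (F : ℂ → Matrix (Fin p) (Fin q) ℂ) :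
    ∀ᵐ ω : ℝ, spectralENorm (F (Complex.I * ω)) ≤ linftyNorm F := by
  open scoped Matrix.Norms.L2Operator in
  rw [linftyNorm, eLpNorm_exponent_top]
  exact ae_le_eLpNormEssSup

/-- Expanding in matrix units bounds the spectral norm by the entries through the triangle
inequality alone. -/
theorem memLinfty_of_entries_bounded {F : ℂ → Matrix (Fin p) (Fin q) ℂ}
    (hc : Continuous fun ω : ℝ => F (Complex.I * ω))
    (hb : ∀ i j, ∃ K : ℝ, ∀ ω : ℝ, ‖F (Complex.I * ω) i j‖ ≤ K) : MemLinfty F := by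
  open scoped Matrix.Norms.L2Operator in
  choose K hK using hb
  refine memLp_top_of_bound (hc.aestronglyMeasurable)
    (∑ i, ∑ j, K i j * ‖(single i j 1 : Matrix (Fin p) (Fin q) ℂ)‖)
    (Eventually.of_forall fun ω => ?_)
  rw [matrix_eq_sum_single (F (Complex.I * ω))]
  refine (norm_sum_le _ _).trans (Finset.sum_le_sum fun i _ => (norm_sum_le _ _).trans
    (Finset.sum_le_sum fun j _ => ?_))
  have : (single i j (F (Complex.I * ω) i j) : Matrix (Fin p) (Fin q) ℂ) =
      F (Complex.I * ω) i j • single i j 1 := by simp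
  rw [this, norm_smul]
  gcongr
  exact hK i j ω

end MatrixNorms

/-! ### Stable transfer functions and the spectral factorization. -/

section Transfer

open Filter Topology

variable {n m p k r : ℕ}

/-- Resolvent entries of a matrix with spectrum in the open left half plane. -/
theorem decaysOnRightHalfPlane_resolvent_entry {A : Matrix (Fin n) (Fin n) ℂ}
    (hA : ∀ s ∈ spectrum ℂ A, s.re < 0) (a b : Fin n) :
    DecaysOnRightHalfPlane fun s => (s • (1 : Matrix (Fin n) (Fin n) ℂ) - A)⁻¹ a b := by
  let _ : NormedRing (Matrix (Fin n) (Fin n) ℂ) := Matrix.frobeniusNormedRing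
  let _ : NormedAlgebra ℂ (Matrix (Fin n) (Fin n) ℂ) := Matrix.frobeniusNormedAlgebra
  have : CompleteSpace (Matrix (Fin n) (Fin n) ℂ) := FiniteDimensional.complete ℂ _
  let e : Matrix (Fin n) (Fin n) ℂ →L[ℂ] ℂ :=
    LinearMap.toContinuousLinearMap (Matrix.entryLinearMap ℂ ℂ a b)
  have he : ∀ s : ℂ, (s • (1 : Matrix (Fin n) (Fin n) ℂ) - A)⁻¹ a b = e (resolvent A s) := by
    intro s
    rw [resolvent, ← Matrix.nonsing_inv_eq_ringInverse, Algebra.algebraMap_eq_smul_one]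
    rfl
  have hd : ∀ s : ℂ, 0 ≤ s.re → DifferentiableAt ℂ (fun s => e (resolvent A s)) s := by
    intro s hs
    have hs' : s ∈ resolventSet ℂ A := by
      by_contra h
      exact absurd (hA s h) (not_lt.2 hs)
    exact e.differentiableAt.comp s
      (spectrum.hasDerivAt_resolvent_const_left hs').differentiableAt
  simp only [he]
  refine ⟨hd, ?_⟩
  -- Near infinity the resolvent is O(1/s); the rest of the closed half plane is compact, and
  -- continuity suffices there. Taking |s| ≥ 1 in the outer region gives 1 + |s|² ≤ 2|s|², hence the
  -- constant 2c².
  have hO : (fun s => e (resolvent A s)) =O[Bornology.cobounded ℂ] (Inv.inv : ℂ → ℂ) :=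
    (e.isBigO_comp (resolvent A) _).trans (spectrum.resolvent_isBigO_inv A)
  obtain ⟨c, hc⟩ := hO.bound
  obtain ⟨R, -, hR⟩ := Filter.hasBasis_cobounded_norm.eventually_iff.1 hc
  have hcomp : IsCompact (Metric.closedBall (0 : ℂ) (max R 1) ∩ {s : ℂ | 0 ≤ s.re}) :=
    (isCompact_closedBall _ _).inter_right (isClosed_le continuous_const Complex.continuous_re)
  obtain ⟨K, hK⟩ := hcomp.exists_bound_of_continuousOn
    (f := fun s => ‖e (resolvent A s)‖ ^ 2 * (1 + ‖s‖ ^ 2)) (by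
      intro s hs
      exact (((hd s hs.2).continuousAt.norm.pow 2).mul (by fun_prop)).continuousWithinAt)
  refine ⟨max K (2 * c ^ 2), fun s hs => ?_⟩
  rw [← div_eq_mul_inv, le_div_iff₀ (by positivity)]
  by_cases h : ‖s‖ ≤ max R 1
  · refine le_trans ?_ (le_max_left _ _)
    exact (le_abs_self _).trans (hK s ⟨by simpa using h, hs⟩)
  · refine le_trans ?_ (le_max_right _ _)
    have h' := not_le.1 h
    have hRs : R ≤ ‖s‖ := (le_max_left _ _).trans h'.le
    have h1s : 1 ≤ ‖s‖ := (le_max_right _ _).trans h'.le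
    have hb := hR hRs
    rw [norm_inv] at hb
    have hb2 := pow_le_pow_left₀ (norm_nonneg _) hb 2
    have h2 : (1 + ‖s‖ ^ 2) ≤ 2 * ‖s‖ ^ 2 := by nlinarith
    calc ‖e (resolvent A s)‖ ^ 2 * (1 + ‖s‖ ^ 2) ≤ (c * ‖s‖⁻¹) ^ 2 * (2 * ‖s‖ ^ 2) := by gcongr
      _ = 2 * c ^ 2 := by field_simp

namespace LTISystem

/-- The strictly proper part of a stable transfer function. -/
theorem IsAsymptoticallyStable.decays {S : LTISystem n m p} (hS : S.IsAsymptoticallyStable)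
    (i : Fin p) (j : Fin m) :
    DecaysOnRightHalfPlane fun s => (S.transferFunction s - S.D.toComplex) i j := by
  simp only [transferFunction, add_sub_cancel_right, Matrix.mul_apply, Finset.sum_mul]
  refine .sum fun b _ => .sum fun a _ => ?_
  have := (decaysOnRightHalfPlane_resolvent_entry hS a b).const_mul
    (S.C.toComplex i a * S.B.toComplex b j)
  convert this using 2
  ring

theorem IsAsymptoticallyStable.continuousAt {S : LTISystem n m p}
    (hS : S.IsAsymptoticallyStable) {s : ℂ} (hs : 0 ≤ s.re) :
    ContinuousAt S.transferFunction s := by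
  refine continuousAt_pi.2 fun i => continuousAt_pi.2 fun j => ?_
  simpa using ((hS.decays i j).differentiableAt s hs).continuousAt.add_const (S.D.toComplex i j)

theorem IsAsymptoticallyStable.continuous_imaginaryAxis {S : LTISystem n m p}
    (hS : S.IsAsymptoticallyStable) :
    Continuous fun ω : ℝ => S.transferFunction (Complex.I * ω) :=
  continuous_iff_continuousAt.2 fun y => ContinuousAt.comp (f := fun ω : ℝ => Complex.I * ω)
    (hS.continuousAt (by simp)) (by fun_prop)

theorem IsAsymptoticallyStable.entry_bounded {S : LTISystem n m p}
    (hS : S.IsAsymptoticallyStable) (i : Fin p) (j : Fin m) :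
    ∃ K : ℝ, ∀ ω : ℝ, ‖S.transferFunction (Complex.I * ω) i j‖ ≤ K := by
  obtain ⟨K, hK0, hK⟩ := (hS.decays i j).exists_bound_im
  -- The strictly proper part has t² ≤ K, and 2t ≤ t² + 1 turns this into a bound on t without a
  -- square root.
  refine ⟨(K + 1) + ‖S.D.toComplex i j‖, fun ω => ?_⟩
  have h := hK 0 ω le_rfl
  have h1 : K * (1 + ω ^ 2)⁻¹ ≤ K :=
    mul_le_of_le_one_right hK0 (inv_le_one_of_one_le₀ (by nlinarith [sq_nonneg ω]))
  simp only [Complex.ofReal_zero, zero_add, Matrix.sub_apply] at h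
  have h2 := norm_add_le (S.transferFunction (Complex.I * ω) i j - S.D.toComplex i j)
    (S.D.toComplex i j)
  rw [sub_add_cancel] at h2
  nlinarith [sq_nonneg (‖S.transferFunction (Complex.I * ω) i j - S.D.toComplex i j‖ - 1)]

theorem IsAsymptoticallyStable.memLinfty {S : LTISystem n m p}
    (hS : S.IsAsymptoticallyStable) : MemLinfty S.transferFunction :=
  memLinfty_of_entries_bounded hS.continuous_imaginaryAxis hS.entry_bounded

theorem IsAsymptoticallyStable.memLinfty_transpose_neg {S : LTISystem n m p}
    (hS : S.IsAsymptoticallyStable) : MemLinfty fun s => (S.transferFunction (-s))ᵀ := by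
  have hneg : ∀ ω : ℝ, -(Complex.I * ω) = Complex.I * ((-ω : ℝ) : ℂ) := fun ω => by
    push_cast; ring
  refine memLinfty_of_entries_bounded ?_ fun i j => ?_
  · simp only [hneg]
    exact (hS.continuous_imaginaryAxis.comp continuous_neg).matrix_transpose
  · obtain ⟨K, hK⟩ := hS.entry_bounded j i
    refine ⟨K, fun ω => ?_⟩
    rw [transpose_apply, hneg]
    exact hK (-ω)

/-- Stable transfer functions whose difference is in `H₂` have the same feedthrough matrix. -/
theorem feedthrough_eq_of_memH2_sub {S : LTISystem n m p} {S' : LTISystem r m p}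
    (hS : S.IsAsymptoticallyStable) (hS' : S'.IsAsymptoticallyStable)
    (h : MemH2 (S.transferFunction - S'.transferFunction)) : S.D = S'.D := by
  ext i j
  -- On the line Re s = 1 the difference is square integrable, and so are both strictly proper
  -- parts. What remains is the constant D - D', which is square integrable over ℝ only if it is
  -- zero.
  have hfin : ∫⁻ ω : ℝ, frobeniusENorm ((S.transferFunction - S'.transferFunction)
      ((1 : ℝ) + Complex.I * ω)) ^ 2 < ∞ := by
    have := h.2
    rw [h2Norm_eq, ENNReal.rpow_lt_top_iff_of_pos (by norm_num)] at this
    exact (le_iSup₂_of_le (1 : ℝ) one_pos le_rfl).trans_lt this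
  have hdec := fun {q : ℕ} {T : LTISystem q m p} (hT : T.IsAsymptoticallyStable) =>
    (memLp_two_iff_integrable_sq_norm
      ((hT.decays i j).continuous_vertical zero_le_one).aestronglyMeasurable).2
      ((hT.decays i j).integrable_sq zero_le_one)
  have hcont : ∀ {q : ℕ} {T : LTISystem q m p}, T.IsAsymptoticallyStable →
      Continuous fun ω : ℝ => T.transferFunction ((1 : ℝ) + Complex.I * ω) i j := fun {q T} hT => by
    simpa using ((hT.decays i j).continuous_vertical zero_le_one).add_const
      (T.D.toComplex i j)
  have hE : MemLp (fun ω : ℝ => (S.transferFunction - S'.transferFunction)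
      ((1 : ℝ) + Complex.I * ω) i j) 2 volume := by
    refine ⟨((hcont hS).sub (hcont hS')).aestronglyMeasurable, ?_⟩
    rw [eLpNorm_lt_top_iff_lintegral_rpow_enorm_lt_top two_ne_zero ENNReal.ofNat_ne_top]
    refine (lintegral_mono fun ω => ?_).trans_lt hfin
    simpa using enorm_entry_sq_le_frobeniusENorm ((S.transferFunction - S'.transferFunction)
      ((1 : ℝ) + Complex.I * ω)) i j
  have hconst : MemLp (fun _ : ℝ => S.D.toComplex i j - S'.D.toComplex i j) 2 volume := by
    convert (hE.sub (hdec hS)).add (hdec hS') using 1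
    ext ω
    simp
  rw [memLp_const_iff two_ne_zero ENNReal.ofNat_ne_top] at hconst
  simpa [sub_eq_zero] using hconst

/-- The coefficient matrices are real, so conjugating the value amounts to conjugating s. On the
axis conj s = -s, which identifies Hᴴ with Hᵀ(-·). -/
theorem conjTranspose_transferFunction (S : LTISystem n m p) (s : ℂ) :
    (S.transferFunction s)ᴴ = (S.transferFunction (starRingEnd ℂ s))ᵀ := by
  have hreal : ∀ {a b : ℕ} (M : Matrix (Fin a) (Fin b) ℝ), M.toComplexᴴ = M.toComplexᵀ := by
    intro a b M; ext i j; simp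
  simp only [transferFunction, conjTranspose_add, conjTranspose_mul, transpose_add, transpose_mul,
    conjTranspose_nonsing_inv, transpose_nonsing_inv, conjTranspose_sub, transpose_sub,
    conjTranspose_smul, transpose_smul, conjTranspose_one, transpose_one, hreal, RCLike.star_def]

theorem IsAsymptoticallyStable.isUnit_det {S : LTISystem n m p} (hS : S.IsAsymptoticallyStable)
    {s : ℂ} (hs : 0 ≤ s.re) :
    IsUnit (s • (1 : Matrix (Fin n) (Fin n) ℂ) - S.A.toComplex).det := by
  rw [← Matrix.isUnit_iff_isUnit_det, ← Algebra.algebraMap_eq_smul_one]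
  by_contra h
  exact absurd (hS s h) (not_lt.2 hs)

end LTISystem

/-- The algebra behind the spectral factorization, with `P = (s I - A)⁻¹` and
`Q = (-s I - A)⁻¹`. -/
theorem kyp_factorization_identity {a x P Q : Matrix (Fin n) (Fin n) ℂ}
    {b : Matrix (Fin n) (Fin m) ℂ} {c : Matrix (Fin m) (Fin n) ℂ} {d : Matrix (Fin m) (Fin m) ℂ}
    {l : Matrix (Fin k) (Fin n) ℂ} {M : Matrix (Fin k) (Fin m) ℂ} {s : ℂ}
    (h11 : lᵀ * l = -(aᵀ * x) - x * a) (h12 : lᵀ * M = cᵀ - x * b)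
    (h21 : Mᵀ * l = c - bᵀ * x) (h22 : Mᵀ * M = d + dᵀ)
    (hP : (s • 1 - a) * P = 1) (hQ : ((-s) • 1 - a) * Q = 1) :
    (l * Q * b + M)ᵀ * (l * P * b + M) = c * P * b + d + (c * Q * b + d)ᵀ := by
  have hQ' : Qᵀ * ((-s) • 1 - aᵀ) = 1 := by
    simpa [transpose_mul] using congrArg transpose hQ
  have key : Qᵀ * (lᵀ * l) * P = x * P + Qᵀ * x := by
    -- The terms ±s x cancel. Each summand then has a factor that Qᵀ on the left or P on the right
    -- inverts.
    have : lᵀ * l = ((-s) • 1 - aᵀ) * x + x * (s • 1 - a) := by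
      rw [h11]; simp [Matrix.sub_mul, Matrix.mul_sub]; abel
    rw [this, Matrix.mul_add, Matrix.add_mul, ← Matrix.mul_assoc, hQ', Matrix.one_mul,
      Matrix.mul_assoc, Matrix.mul_assoc, hP, Matrix.mul_one]
  calc (l * Q * b + M)ᵀ * (l * P * b + M)
      = bᵀ * (Qᵀ * (lᵀ * l) * P) * b + bᵀ * Qᵀ * (lᵀ * M) + (Mᵀ * l) * P * b + Mᵀ * M := by
        simp only [transpose_add, transpose_mul, Matrix.mul_add, Matrix.add_mul, Matrix.mul_assoc]
        abel
    _ = _ := by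
        rw [key, h12, h21, h22]
        simp only [transpose_add, transpose_mul, Matrix.mul_add, Matrix.add_mul, Matrix.mul_sub,
          Matrix.sub_mul, Matrix.mul_assoc]
        abel

namespace LTISystem

/-- On the imaginary axis, `G + Gᴴ = Hᴴ H` for a spectral factor `H` of `G`. -/
theorem IsSpectralFactor.transferFunction_add_conjTranspose {S : LTISystem n m m}
    {SH : LTISystem n m k} (h : S.IsSpectralFactor SH) (hS : S.IsAsymptoticallyStable) (ω : ℝ) :
    S.transferFunction (Complex.I * ω) + (S.transferFunction (Complex.I * ω))ᴴ =
      (SH.transferFunction (Complex.I * ω))ᴴ * SH.transferFunction (Complex.I * ω) := by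
  obtain ⟨hA, hB, X, -, hX⟩ := h
  have hconj : starRingEnd ℂ (Complex.I * ω) = -(Complex.I * ω) := by simp
  rw [kypMatrix, transpose_fromCols, fromRows_mul_fromCols, fromBlocks_inj] at hX
  obtain ⟨h11, h12, h21, h22⟩ := hX
  have hmul : ∀ {a b c : ℕ} (M : Matrix (Fin a) (Fin b) ℝ) (N : Matrix (Fin b) (Fin c) ℝ),
      (M * N).toComplex = M.toComplex * N.toComplex := fun M N =>
    Matrix.map_mul (f := Complex.ofRealHom)
  have hadd : ∀ {a b : ℕ} (M N : Matrix (Fin a) (Fin b) ℝ),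
      (M + N).toComplex = M.toComplex + N.toComplex := fun M N => by ext; simp
  have hsub : ∀ {a b : ℕ} (M N : Matrix (Fin a) (Fin b) ℝ),
      (M - N).toComplex = M.toComplex - N.toComplex := fun M N => by ext; simp
  have hneg : ∀ {a b : ℕ} (M : Matrix (Fin a) (Fin b) ℝ),
      (-M).toComplex = -M.toComplex := fun M => by ext; simp
  have htr : ∀ {a b : ℕ} (M : Matrix (Fin a) (Fin b) ℝ),
      Mᵀ.toComplex = M.toComplexᵀ := fun M => rfl
  replace h11 := congrArg Matrix.toComplex h11
  replace h12 := congrArg Matrix.toComplex h12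
  replace h21 := congrArg Matrix.toComplex h21
  replace h22 := congrArg Matrix.toComplex h22
  simp only [hmul, hadd, hsub, hneg, htr] at h11 h12 h21 h22
  rw [conjTranspose_transferFunction, conjTranspose_transferFunction, hconj]
  simp only [transferFunction, hA, hB]
  refine (kyp_factorization_identity h11.symm h12.symm h21.symm h22.symm
    (Matrix.mul_nonsing_inv _ (hS.isUnit_det (by simp)))
    (Matrix.mul_nonsing_inv _ (hS.isUnit_det (by simp)))).symm

end LTISystem

end Transfer

/-! ### The estimate. -/

theorem mainTheorem2 {n r m k : ℕ}
    (S : LTISystem n m m) (S' : LTISystem r m m)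
    (hpass : S.IsPassive) (hpass' : S'.IsPassive)
    (hmin : S.IsMinimal) (hmin' : S'.IsMinimal)
    (hstab : S.IsAsymptoticallyStable) (hstab' : S'.IsAsymptoticallyStable)
    (SH : LTISystem n m k) (SH' : LTISystem r m k)
    (hSH : S.IsSpectralFactor SH) (hSH' : S'.IsSpectralFactor SH')
    (hG : MemH2 (S.transferFunction - S'.transferFunction))
    (hH : MemH2 (SH.transferFunction - SH'.transferFunction)) :
    MemLinfty (fun s => (SH.transferFunction (-s))ᵀ) ∧
    MemLinfty SH'.transferFunction ∧
    h2Norm (S.transferFunction - S'.transferFunction) ≤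
      spectralFactorConstant SH.transferFunction SH'.transferFunction *
        h2Norm (SH.transferFunction - SH'.transferFunction) := by
  have hstabH : SH.IsAsymptoticallyStable := by
    have := hSH.1
    simpa only [LTISystem.IsAsymptoticallyStable, this] using hstab
  have hstabH' : SH'.IsAsymptoticallyStable := by
    have := hSH'.1
    simpa only [LTISystem.IsAsymptoticallyStable, this] using hstab'
  have hL := hstabH.memLinfty_transpose_neg
  have hL' := hstabH'.memLinfty
  refine ⟨hL, hL', ?_⟩
  have hD := LTISystem.feedthrough_eq_of_memH2_sub hstab hstab' hG
  set E := S.transferFunction - S'.transferFunction with hEdef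
  set F := SH.transferFunction - SH'.transferFunction with hFdef
  set γ := linftyNorm (fun s => (SH.transferFunction (-s))ᵀ) + linftyNorm SH'.transferFunction
    with hγ
  have hγtop : γ ≠ ∞ := ENNReal.add_ne_top.2 ⟨hL.2.ne, hL'.2.ne⟩
  -- Equal feedthrough terms cancel, so E is the difference of the strictly proper parts.
  have hE : ∀ i j, DecaysOnRightHalfPlane fun s => E s i j := by
    intro i j
    convert (hstab.decays i j).add ((hstab'.decays i j).const_mul (-1)) using 1
    ext s
    simp [hEdef, hD]
  have hFc : ∀ s : ℂ, 0 ≤ s.re → ContinuousAt F s := fun s hs =>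
    (hstabH.continuousAt hs).sub (hstabH'.continuousAt hs)
  -- The mixed terms ∓Hᴴ H̃ cancel. This splitting pairs F once with H and once with H̃, hence the
  -- sum of two norms in the constant.
  have hident : ∀ ω : ℝ, E (Complex.I * ω) + (E (Complex.I * ω))ᴴ =
      (SH.transferFunction (Complex.I * ω))ᴴ * F (Complex.I * ω) +
        (F (Complex.I * ω))ᴴ * SH'.transferFunction (Complex.I * ω) := by
    intro ω
    have h1 := hSH.transferFunction_add_conjTranspose hstab ω
    have h2 := hSH'.transferFunction_add_conjTranspose hstab' ω
    simp only [hEdef, hFdef, Pi.sub_apply, conjTranspose_sub, Matrix.mul_sub, Matrix.sub_mul,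
      ← h1, ← h2]
    abel
  have hae : ∀ᵐ ω : ℝ, frobeniusENorm (E (Complex.I * ω) + (E (Complex.I * ω))ᴴ) ^ 2 ≤
      γ ^ 2 * frobeniusENorm (F (Complex.I * ω)) ^ 2 := by
    filter_upwards [ae_spectralENorm_le_linftyNorm fun s => (SH.transferFunction (-s))ᵀ,
      ae_spectralENorm_le_linftyNorm SH'.transferFunction] with ω h1 h2
    rw [← mul_pow, hident, hγ, add_mul]
    gcongr
    refine (frobeniusENorm_add_le _ _).trans (add_le_add ?_ ?_)
    · refine (frobeniusENorm_mul_le_left _ _).trans ?_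
      rw [LTISystem.conjTranspose_transferFunction,
        show starRingEnd ℂ (Complex.I * ω) = -(Complex.I * ω) by simp]
      gcongr
    · refine (frobeniusENorm_mul_le_right _ _).trans ?_
      rw [frobeniusENorm_conjTranspose]
      gcongr
  have hint : 2 * ∫⁻ ω : ℝ, frobeniusENorm (E (Complex.I * ω)) ^ 2 ≤
      γ ^ 2 * ∫⁻ ω : ℝ, frobeniusENorm (F (Complex.I * ω)) ^ 2 := by
    -- Finiteness of γ lets it leave the integral without a measurability argument.
    rw [← lintegral_add_conjTranspose hE, ← lintegral_const_mul' _ _ (ENNReal.pow_ne_top hγtop)]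
    exact lintegral_mono_ae hae
  have hroot := ENNReal.rpow_le_rpow hint (show (0 : ℝ) ≤ 1 / 2 by norm_num)
  rw [ENNReal.mul_rpow_of_nonneg _ _ (by norm_num), ENNReal.mul_rpow_of_nonneg _ _ (by norm_num),
    ← ENNReal.rpow_natCast γ, ← ENNReal.rpow_mul] at hroot
  have hsqrt : ENNReal.ofReal (Real.sqrt 2) = (2 : ℝ≥0∞) ^ (1 / 2 : ℝ) := by
    rw [Real.sqrt_eq_rpow, ← ENNReal.ofReal_rpow_of_pos two_pos, ENNReal.ofReal_ofNat]
  have hs0 : ENNReal.ofReal (Real.sqrt 2) ≠ 0 := by simp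
  norm_num at hroot
  calc h2Norm E ≤ (∫⁻ ω : ℝ, frobeniusENorm (E (Complex.I * ω)) ^ 2) ^ (1 / 2 : ℝ) :=
        h2Norm_le_lintegral_imaginaryAxis hE
    _ ≤ γ / ENNReal.ofReal (Real.sqrt 2) *
        (∫⁻ ω : ℝ, frobeniusENorm (F (Complex.I * ω)) ^ 2) ^ (1 / 2 : ℝ) := by
        rw [ENNReal.mul_comm_div, ← mul_div_assoc, ENNReal.le_div_iff_mul_le (.inl hs0)
          (.inl ENNReal.ofReal_ne_top), hsqrt, mul_comm]
        norm_num
        exact hroot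
    _ ≤ γ / ENNReal.ofReal (Real.sqrt 2) * h2Norm F := by
        gcongr
        exact lintegral_imaginaryAxis_le_h2Norm hFc
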